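/- Let $T$ be a simplicial tree (not necessarily locally finite), identified with its geometric realisation, in which every edge is a segment of length $1$, and let $d$ be the resulting path metric. Let $\mathrm{Aut}(T)$ be the group of simplicial (graph) automorphisms of $T$, equipped with the compact-open topology coming from its action on the geometric realisation. For $g \in \mathrm{Aut}(T)$, the translation length is $l(g) = \min\{d(w, gw) : w \in T\}$, where $w$ ranges over all points of the geometric realisation (vertices and points of edges); $g$ is called hyperbolic if $l(g) > 0$, and elliptic otherwise (so an automorphism that inverts an edge is elliptic). A subgroup $G \le \mathrm{Aut}(T)$ is called purely hyperbolic if all its nontrivial elements are hyperbolic, and discrete if its subspace topology is discrete. Let $G$ be any subgroup of $\mathrm{Aut}(T)$. (1) If $T$ is locally finite (every vertex has finitely many neighbours) and $G$ is discrete and is a free group, then $G$ is purely hyperbolic. (2) If $G$ is purely hyperbolic, then $G$ is discrete and is a free group. -/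

import Mathlib

namespace TreeAut

/-- The set underlying the geometric realisation of a simple graph `T`, in barycentric coordinates:
a point is a finitely supported family of nonnegative weights on the vertices with total weight `1`,
whose support is a vertex or (the pair of endpoints of) an edge. -/
@[ext]
structure Realisation {V : Type*} (T : SimpleGraph V) where
  coord : V →₀ ℝ
  nonneg : ∀ v, 0 ≤ coord v
  sum_eq_one : (coord.sum fun _ t => t) = 1
  card_support_le : coord.support.card ≤ 2
  adj_of_mem : ∀ u ∈ coord.support, ∀ v ∈ coord.support, u ≠ v → T.Adj u v

namespace Realisation

variable {V : Type*} {T : SimpleGraph V}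

/-- A vertex, as a point of the realisation. -/
noncomputable def vertex (T : SimpleGraph V) (v : V) : Realisation T where
  coord := Finsupp.single v 1
  nonneg u := by
    classical
    rw [Finsupp.single_apply]; split_ifs <;> norm_num
  sum_eq_one := by simp
  card_support_le := by
    rw [Finsupp.support_single v one_ne_zero]; simp
  adj_of_mem := by
    intro u hu w hw h
    rw [Finsupp.support_single v one_ne_zero] at hu hw
    simp only [Finset.mem_singleton] at hu hw
    exact absurd (hu.trans hw.symm) h

/-- Two points lie on a common (closed) edge. -/
def OnCommonEdge (x y : Realisation T) : Prop :=
  ∃ u v, T.Adj u v ∧ (x.coord.support : Set V) ⊆ {u, v} ∧ (y.coord.support : Set V) ⊆ {u, v}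

open scoped Classical in
/-- The path metric on the realisation in which every edge is a segment of length `1`. On a common
edge, the distance is the difference of the barycentric coordinates. Otherwise a path from `x` to
`y` leaves the edge (or vertex) carrying `x` through one of its endpoints `u`, then runs to an
endpoint `v` of the edge (or vertex) carrying `y`, and then to `y`. -/
noncomputable def pathDist (x y : Realisation T) : ℝ :=
  if OnCommonEdge x y then
    ((x.coord - y.coord).sum fun _ t => |t|) / 2
  else
    ⨅ p : x.coord.support × y.coord.support,
      ((1 - x.coord p.1) + (T.dist (p.1 : V) (p.2 : V) : ℝ) + (1 - y.coord p.2))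

lemma exists_mem_support (x : Realisation T) : ∃ u, u ∈ x.coord.support := by
  by_contra! h
  have h0 : x.coord = 0 := by
    ext v; simpa using h v
  have := x.sum_eq_one
  rw [h0] at this
  simp at this

lemma coord_cases (x : Realisation T) {u : V} (hu : u ∈ x.coord.support) :
    x.coord = Finsupp.single u 1 ∨
      ∃ u', T.Adj u u' ∧ u' ∈ x.coord.support ∧ x.coord u + x.coord u' = 1 ∧
        (x.coord.support : Set V) = {u, u'} := by
  classical
  by_cases h : ∃ u' ∈ x.coord.support, u ≠ u'
  · obtain ⟨u', hu', hne⟩ := h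
    have hs : x.coord.support = ({u, u'} : Finset V) := by
      symm
      apply Finset.eq_of_subset_of_card_le
      · intro z hz
        simp only [Finset.mem_insert, Finset.mem_singleton] at hz
        rcases hz with rfl | rfl <;> assumption
      · rw [Finset.card_pair hne]; exact x.card_support_le
    refine Or.inr ⟨u', x.adj_of_mem u hu u' hu' hne, hu', ?_, by rw [hs]; simp⟩
    have := x.sum_eq_one
    rwa [Finsupp.sum, hs, Finset.sum_pair hne] at this
  · push Not at h
    left
    have hs : x.coord.support = {u} := by
      ext z
      simp only [Finset.mem_singleton]
      exact ⟨fun hz => (h z hz).symm, fun hz => hz ▸ hu⟩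
    have h1 : x.coord u = 1 := by
      have := x.sum_eq_one
      rwa [Finsupp.sum, hs, Finset.sum_singleton] at this
    ext z
    rw [Finsupp.single_apply]
    split_ifs with hz
    · rw [← hz, h1]
    · rw [← Finsupp.notMem_support_iff, hs]
      simpa using fun h => hz h.symm

/-- The weighted distance of a point from a vertex; an auxiliary function for the triangle
inequality. -/
noncomputable def height (x : Realisation T) (v : V) : ℝ :=
  x.coord.sum fun u t => t * (T.dist u v : ℝ)

lemma height_of_subset (x : Realisation T) {a b : V} (hab : a ≠ b)
    (hx : (x.coord.support : Set V) ⊆ {a, b}) (v : V) :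
    x.height v = x.coord a * T.dist a v + x.coord b * T.dist b v := by
  classical
  rw [height, Finsupp.sum_of_support_subset (s := {a, b}) _ (by
    intro z hz; simpa using hx hz) _ (by simp), Finset.sum_pair hab]

lemma coord_add_of_subset (x : Realisation T) {a b : V} (hab : a ≠ b)
    (hx : (x.coord.support : Set V) ⊆ {a, b}) : x.coord a + x.coord b = 1 := by
  classical
  rw [← x.sum_eq_one, Finsupp.sum_of_support_subset (s := {a, b}) _ (by
    intro z hz; simpa using hx hz) _ (by simp), Finset.sum_pair hab]

lemma height_of_single (x : Realisation T) {u : V} (hx : x.coord = Finsupp.single u 1) (v : V) :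
    x.height v = T.dist u v := by
  rw [height, hx, Finsupp.sum_single_index] <;> simp

lemma pathDist_of_edge {x y : Realisation T} {a b : V} (hab : T.Adj a b)
    (hx : (x.coord.support : Set V) ⊆ {a, b}) (hy : (y.coord.support : Set V) ⊆ {a, b}) :
    pathDist x y = |x.coord a - y.coord a| := by
  classical
  have h1 := x.coord_add_of_subset hab.ne hx
  have h2 := y.coord_add_of_subset hab.ne hy
  rw [pathDist, if_pos ⟨a, b, hab, hx, hy⟩,
    Finsupp.sum_of_support_subset (s := {a, b}) _ (by
      intro z hz
      have hz' := Finsupp.support_sub hz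
      rw [Finset.mem_union] at hz'
      rcases hz' with h | h
      · simpa using hx h
      · simpa using hy h) _ (by simp), Finset.sum_pair hab.ne]
  have h3 : x.coord b - y.coord b = -(x.coord a - y.coord a) := by linarith
  simp only [Finsupp.coe_sub, Pi.sub_apply]
  rw [h3, abs_neg]
  ring

lemma pathDist_le {x y : Realisation T} (h : ¬ OnCommonEdge x y) {u v : V}
    (hu : u ∈ x.coord.support) (hv : v ∈ y.coord.support) :
    pathDist x y ≤ (1 - x.coord u) + T.dist u v + (1 - y.coord v) := by
  rw [pathDist, if_neg h]
  exact ciInf_le (Set.finite_range _).bddBelow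
    (⟨⟨u, hu⟩, ⟨v, hv⟩⟩ : x.coord.support × y.coord.support)

lemma exists_pathDist_eq {x y : Realisation T} (h : ¬ OnCommonEdge x y) :
    ∃ u ∈ x.coord.support, ∃ v ∈ y.coord.support,
      pathDist x y = (1 - x.coord u) + T.dist u v + (1 - y.coord v) := by
  obtain ⟨u, hu⟩ := x.exists_mem_support
  obtain ⟨v, hv⟩ := y.exists_mem_support
  have : Nonempty (x.coord.support × y.coord.support) := ⟨⟨⟨u, hu⟩, ⟨v, hv⟩⟩⟩
  rw [pathDist, if_neg h]
  obtain ⟨p, hp⟩ := exists_eq_ciInf_of_finite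
    (f := fun p : x.coord.support × y.coord.support =>
      ((1 - x.coord p.1) + (T.dist (p.1 : V) (p.2 : V) : ℝ) + (1 - y.coord p.2)))
  exact ⟨p.1, p.1.2, p.2, p.2.2, hp.symm⟩

lemma coord_le_one (x : Realisation T) (u : V) : x.coord u ≤ 1 := by
  by_cases hu : u ∈ x.coord.support
  · rcases x.coord_cases hu with h | ⟨u', -, -, h, -⟩
    · rw [h]; simp
    · linarith [x.nonneg u']
  · rw [Finsupp.notMem_support_iff.1 hu]; norm_num

lemma onCommonEdge_comm {x y : Realisation T} : OnCommonEdge x y ↔ OnCommonEdge y x :=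
  ⟨fun ⟨u, v, h, hx, hy⟩ => ⟨u, v, h, hy, hx⟩, fun ⟨u, v, h, hx, hy⟩ => ⟨u, v, h, hy, hx⟩⟩

lemma pathDist_self (x : Realisation T) : pathDist x x = 0 := by
  classical
  obtain ⟨u, hu⟩ := x.exists_mem_support
  rcases x.coord_cases hu with h | ⟨u', hadj, -, -, hs⟩
  · by_cases hc : OnCommonEdge x x
    · rw [pathDist, if_pos hc]; simp
    · obtain ⟨a, ha, b, hb, hab⟩ := exists_pathDist_eq hc
      rw [h, Finsupp.support_single u one_ne_zero] at ha hb
      simp only [Finset.mem_singleton] at ha hb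
      subst ha; subst hb
      rw [hab, h]; simp
  · have hx : (x.coord.support : Set V) ⊆ {u, u'} := hs.subset
    rw [pathDist_of_edge hadj hx hx]; simp

lemma pathDist_comm (x y : Realisation T) : pathDist x y = pathDist y x := by
  by_cases hc : OnCommonEdge x y
  · obtain ⟨a, b, hab, hx, hy⟩ := hc
    rw [pathDist_of_edge hab hx hy, pathDist_of_edge hab hy hx, abs_sub_comm]
  · have hc' : ¬ OnCommonEdge y x := fun h => hc (onCommonEdge_comm.1 h)
    apply le_antisymm
    · obtain ⟨u, hu, v, hv, h⟩ := exists_pathDist_eq hc'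
      rw [h, T.dist_comm]
      linarith [pathDist_le hc hv hu]
    · obtain ⟨u, hu, v, hv, h⟩ := exists_pathDist_eq hc
      rw [h, T.dist_comm]
      linarith [pathDist_le hc' hv hu]

lemma eq_of_pathDist_eq_zero (hT : T.IsTree) {x y : Realisation T} (h : pathDist x y = 0) :
    x = y := by
  classical
  by_cases hc : OnCommonEdge x y
  · obtain ⟨a, b, hab, hx, hy⟩ := hc
    rw [pathDist_of_edge hab hx hy, abs_eq_zero] at h
    have h1 := x.coord_add_of_subset hab.ne hx
    have h2 := y.coord_add_of_subset hab.ne hy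
    ext z
    by_cases hza : z = a
    · rw [hza]; linarith
    by_cases hzb : z = b
    · rw [hzb]; linarith
    have e1 : x.coord z = 0 := by
      by_contra hz
      rcases hx (show z ∈ (x.coord.support : Set V) by simpa using hz) with h | h
      exacts [hza h, hzb h]
    have e2 : y.coord z = 0 := by
      by_contra hz
      rcases hy (show z ∈ (y.coord.support : Set V) by simpa using hz) with h | h
      exacts [hza h, hzb h]
    rw [e1, e2]
  · obtain ⟨u, hu, v, hv, huv⟩ := exists_pathDist_eq hc
    rw [h] at huv
    have h1 := x.coord_le_one u
    have h2 := y.coord_le_one v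
    have h3 : (0 : ℝ) ≤ T.dist u v := Nat.cast_nonneg _
    have h4 : (T.dist u v : ℝ) = 0 := by linarith
    have h5 : u = v := hT.connected.dist_eq_zero_iff.1 (by exact_mod_cast h4)
    subst h5
    have hx : x.coord = Finsupp.single u 1 := by
      rcases x.coord_cases hu with h | ⟨u', -, hu', hs, -⟩
      · exact h
      · have : x.coord u' = 0 := by linarith
        exact absurd this (by simpa using hu')
    have hy : y.coord = Finsupp.single u 1 := by
      rcases y.coord_cases hv with h | ⟨u', -, hu', hs, -⟩
      · exact h
      · have : y.coord u' = 0 := by linarith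
        exact absurd this (by simpa using hu')
    exact Realisation.ext (hx.trans hy.symm)

lemma abs_dist_sub_le (hT : T.IsTree) {a b : V} (hab : T.Adj a b) (v : V) :
    |(T.dist a v : ℝ) - T.dist b v| ≤ 1 := by
  rw [T.dist_comm (u := a), T.dist_comm (u := b)]
  rcases hT.dist_eq_dist_add_one_of_adj v hab with h | h <;> rw [h] <;> push_cast <;> simp

lemma abs_height_sub_le (hT : T.IsTree) (x : Realisation T) {u : V} (hu : u ∈ x.coord.support)
    (v : V) : |x.height v - T.dist u v| ≤ 1 - x.coord u := by
  rcases x.coord_cases hu with h | ⟨u', hadj, -, hs, hsupp⟩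
  · rw [x.height_of_single h, h]; simp
  · classical
    rw [x.height_of_subset hadj.ne hsupp.subset]
    have e : x.coord u * T.dist u v + x.coord u' * T.dist u' v - T.dist u v
        = x.coord u' * ((T.dist u' v : ℝ) - T.dist u v) := by
      linear_combination (T.dist u v : ℝ) * hs
    rw [e, abs_mul, abs_of_nonneg (x.nonneg u')]
    have := abs_dist_sub_le hT hadj.symm v
    nlinarith [x.nonneg u']

lemma height_sub_le (hT : T.IsTree) (x y : Realisation T) (v : V) :
    x.height v - y.height v ≤ pathDist x y := by
  by_cases hc : OnCommonEdge x y
  · obtain ⟨a, b, hab, hx, hy⟩ := hc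
    rw [pathDist_of_edge hab hx hy, x.height_of_subset hab.ne hx, y.height_of_subset hab.ne hy]
    have h1 := x.coord_add_of_subset hab.ne hx
    have h2 := y.coord_add_of_subset hab.ne hy
    have e : x.coord a * T.dist a v + x.coord b * T.dist b v
        - (y.coord a * T.dist a v + y.coord b * T.dist b v)
        = (x.coord a - y.coord a) * ((T.dist a v : ℝ) - T.dist b v) := by
      linear_combination (T.dist b v : ℝ) * (h1 - h2)
    rw [e]
    refine (le_abs_self _).trans ?_
    rw [abs_mul]
    exact mul_le_of_le_one_right (abs_nonneg _) (abs_dist_sub_le hT hab v)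
  · obtain ⟨u, hu, w, hw, h⟩ := exists_pathDist_eq hc
    rw [h]
    have h1 := abs_le.1 (abs_height_sub_le hT x hu v)
    have h2 := abs_le.1 (abs_height_sub_le hT y hw v)
    have h3 : (T.dist u v : ℝ) ≤ T.dist u w + T.dist w v := by
      exact_mod_cast hT.connected.dist_triangle
    linarith [h1.2, h2.1]

/-- In a tree, at most one neighbour of `w` is closer to `u` than `w` is. -/
lemma neighbour_unique (hT : T.IsTree) {u w s t : V} (hs : T.Adj w s) (ht : T.Adj w t)
    (hsu : T.dist u w = T.dist u s + 1) (htu : T.dist u w = T.dist u t + 1) : s = t := by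
  obtain ⟨p, hp⟩ := hT.connected.exists_walk_length_eq_dist u s
  obtain ⟨q, hq⟩ := hT.connected.exists_walk_length_eq_dist u t
  have h1 : (p.concat hs.symm).IsPath :=
    SimpleGraph.Walk.isPath_of_length_eq_dist _ (by rw [SimpleGraph.Walk.length_concat, hp, hsu])
  have h2 : (q.concat ht.symm).IsPath :=
    SimpleGraph.Walk.isPath_of_length_eq_dist _ (by rw [SimpleGraph.Walk.length_concat, hq, htu])
  have h3 := (hT.existsUnique_path u w).unique h1 h2
  have h4 := congrArg SimpleGraph.Walk.penultimate h3
  simpa using h4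

lemma exists_height_sub_eq (hT : T.IsTree) (x y : Realisation T) :
    ∃ v, x.height v - y.height v = pathDist x y := by
  classical
  by_cases hc : OnCommonEdge x y
  · obtain ⟨a, b, hab, hx, hy⟩ := hc
    have h1 := x.coord_add_of_subset hab.ne hx
    have h2 := y.coord_add_of_subset hab.ne hy
    have hd : T.dist a b = 1 := SimpleGraph.dist_eq_one_iff_adj.2 hab
    have hd' : T.dist b a = 1 := SimpleGraph.dist_eq_one_iff_adj.2 hab.symm
    rw [pathDist_of_edge hab hx hy]
    rcases le_total (x.coord a) (y.coord a) with h | h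
    · refine ⟨a, ?_⟩
      rw [abs_of_nonpos (by linarith), x.height_of_subset hab.ne hx, y.height_of_subset hab.ne hy,
        hd', T.dist_self]
      push_cast; linarith
    · refine ⟨b, ?_⟩
      rw [abs_of_nonneg (by linarith), x.height_of_subset hab.ne hx, y.height_of_subset hab.ne hy,
        hd, T.dist_self]
      push_cast; linarith
  · obtain ⟨u, hu, w, hw, h⟩ := exists_pathDist_eq hc
    -- moving away from `x` along the carrier of `y` increases the distance, and symmetrically
    have key : ∀ w', T.Adj w w' → w' ∈ y.coord.support → y.coord w + y.coord w' = 1 →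
        T.dist u w' = T.dist u w + 1 := by
      intro w' hadj hw' hs
      rcases hT.dist_eq_dist_add_one_of_adj u hadj with e | e
      · have h1 := pathDist_le hc hu hw'
        rw [h, e] at h1
        push_cast at h1
        have : 0 < y.coord w' := lt_of_le_of_ne (y.nonneg _) (Ne.symm (by simpa using hw'))
        linarith
      · exact e
    have key' : ∀ u', T.Adj u u' → u' ∈ x.coord.support → x.coord u + x.coord u' = 1 →
        T.dist u' w = T.dist u w + 1 := by
      intro u' hadj hu' hs
      rw [T.dist_comm (u := u'), T.dist_comm (u := u)]
      rcases hT.dist_eq_dist_add_one_of_adj w hadj with e | e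
      · have h1 := pathDist_le hc hu' hw
        rw [h, T.dist_comm (u := u), e, T.dist_comm (u := w)] at h1
        push_cast at h1
        have : 0 < x.coord u' := lt_of_le_of_ne (x.nonneg _) (Ne.symm (by simpa using hu'))
        linarith
      · exact e
    rcases y.coord_cases hw with hy | ⟨w', hww', hw', hys, hysupp⟩
    · refine ⟨w, ?_⟩
      rw [h, y.height_of_single hy, hy]
      rcases x.coord_cases hu with hx | ⟨u', huu', hu', hxs, hxsupp⟩
      · rw [x.height_of_single hx, hx]; simp
      · rw [x.height_of_subset huu'.ne hxsupp.subset, key' u' huu' hu' hxs]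
        simp only [Finsupp.single_eq_same, T.dist_self]
        push_cast
        linear_combination ((T.dist u w : ℝ) + 1) * hxs
    · refine ⟨w', ?_⟩
      have hd : T.dist w w' = 1 := SimpleGraph.dist_eq_one_iff_adj.2 hww'
      have e1 := key w' hww' hw' hys
      rw [h, y.height_of_subset hww'.ne hysupp.subset, T.dist_self, hd]
      rcases x.coord_cases hu with hx | ⟨u', huu', hu', hxs, hxsupp⟩
      · rw [x.height_of_single hx, hx, e1]
        simp only [Finsupp.single_eq_same]
        push_cast
        linarith
      · have e2 := key' u' huu' hu' hxs
        have e3 : T.dist u' w' = T.dist u w + 2 := by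
          rcases hT.dist_eq_dist_add_one_of_adj u' hww' with e | e
          · exfalso
            have hwu' : T.dist u' w' = T.dist u w := by omega
            rcases Nat.eq_zero_or_pos (T.dist u w) with h0 | hpos
            · have a1 : u = w := hT.connected.dist_eq_zero_iff.1 h0
              have a2 : u' = w' := hT.connected.dist_eq_zero_iff.1 (hwu'.trans h0)
              subst a1; subst a2
              exact hc ⟨u, u', huu', hxsupp.subset, hysupp.subset⟩
            · obtain ⟨p, hp⟩ := hT.connected.exists_walk_length_eq_dist w u
              have hne : ¬ p.Nil := by
                rw [← SimpleGraph.Walk.length_eq_zero_iff, hp, T.dist_comm]; omega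
              have ht : T.Adj w p.snd := p.adj_snd hne
              have ht1 : T.dist u p.snd + 1 ≤ T.dist u w := by
                rw [T.dist_comm, T.dist_comm (u := u), ← hp,
                  ← SimpleGraph.Walk.length_tail_add_one hne]
                exact Nat.succ_le_succ (SimpleGraph.dist_le _)
              have ht2 : T.dist u' p.snd ≤ T.dist u' u + T.dist u p.snd :=
                hT.connected.dist_triangle
              have ht3 : T.dist u' u = 1 := SimpleGraph.dist_eq_one_iff_adj.2 huu'.symm
              have ht4 : T.dist u' w = T.dist u' p.snd + 1 := by
                rcases hT.dist_eq_dist_add_one_of_adj u' ht with e' | e' <;> omega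
              have := neighbour_unique hT hww' ht e ht4
              rw [← this] at ht1
              omega
          · omega
        rw [x.height_of_subset huu'.ne hxsupp.subset, e1, e3]
        push_cast
        linear_combination ((T.dist u w : ℝ) + 2) * hxs

lemma pathDist_triangle (hT : T.IsTree) (x y z : Realisation T) :
    pathDist x z ≤ pathDist x y + pathDist y z := by
  obtain ⟨v, hv⟩ := exists_height_sub_eq hT x z
  linarith [height_sub_le hT x y v, height_sub_le hT y z v]

/-- The geometric realisation of a tree as a metric space. -/
noncomputable instance instMetricSpace [hT : Fact T.IsTree] : MetricSpace (Realisation T) where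
  dist := pathDist
  dist_self := pathDist_self
  dist_comm := pathDist_comm
  dist_triangle := pathDist_triangle hT.out
  eq_of_dist_eq_zero := eq_of_pathDist_eq_zero hT.out

/-- The metric extends the graph distance. -/
lemma dist_vertex [hT : Fact T.IsTree] (u v : V) :
    dist (vertex T u) (vertex T v) = T.dist u v := by
  obtain ⟨w, hw⟩ := exists_height_sub_eq hT.out (vertex T u) (vertex T v)
  have h1 := height_sub_le hT.out (vertex T u) (vertex T v) v
  have e (a : V) : (vertex T a).coord = Finsupp.single a 1 := rfl
  simp only [height_of_single _ (e _)] at hw h1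
  change pathDist _ _ = _
  have h3 : (T.dist u w : ℝ) ≤ T.dist u v + T.dist v w := by
    exact_mod_cast hT.out.connected.dist_triangle
  simp only [SimpleGraph.dist_self, Nat.cast_zero, sub_zero] at h1
  linarith

/-- The action of the automorphism group of the graph on its geometric realisation: the weight of
`g • x` at `v` is the weight of `x` at `g⁻¹ v`. -/
noncomputable instance instMulAction : MulAction (T ≃g T) (Realisation T) where
  smul g x :=
    { coord := Finsupp.equivMapDomain g.toEquiv x.coord
      nonneg := fun v => by simpa using x.nonneg _
      sum_eq_one := by rw [Finsupp.sum_equivMapDomain]; exact x.sum_eq_one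
      card_support_le := by
        exact (Finset.card_map _).trans_le x.card_support_le
      adj_of_mem := by
        intro u hu v hv huv
        obtain ⟨a, ha, rfl⟩ := Finset.mem_map.1 hu
        obtain ⟨b, hb, rfl⟩ := Finset.mem_map.1 hv
        exact g.map_rel_iff.2 (x.adj_of_mem a ha b hb (fun h => huv (by rw [h]))) }
  one_smul x := Realisation.ext (Finsupp.equivMapDomain_refl x.coord)
  mul_smul g h x := Realisation.ext (Finsupp.equivMapDomain_trans h.toEquiv g.toEquiv x.coord)

lemma coord_smul (g : T ≃g T) (x : Realisation T) (v : V) :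
    (g • x).coord (g v) = x.coord v := by
  change Finsupp.equivMapDomain g.toEquiv x.coord (g v) = _
  rw [Finsupp.equivMapDomain_apply]
  exact congrArg x.coord (g.toEquiv.symm_apply_apply v)

lemma mem_support_smul (g : T ≃g T) (x : Realisation T) (v : V) :
    g v ∈ (g • x).coord.support ↔ v ∈ x.coord.support := by
  simp [coord_smul]

lemma onCommonEdge_smul (g : T ≃g T) {x y : Realisation T} (h : OnCommonEdge x y) :
    OnCommonEdge (g • x) (g • y) := by
  obtain ⟨a, b, hab, hx, hy⟩ := h
  refine ⟨g a, g b, g.map_rel_iff.2 hab, ?_, ?_⟩ <;>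
  · intro z hz
    obtain ⟨z, rfl⟩ := g.surjective z
    rw [SetLike.mem_coe, mem_support_smul] at hz
    have := by first | exact hx hz | exact hy hz
    rcases this with h | h <;> rw [h] <;> simp

lemma dist_map_le (hT : T.IsTree) (g : T ≃g T) (u v : V) : T.dist (g u) (g v) ≤ T.dist u v := by
  obtain ⟨p, hp⟩ := hT.connected.exists_walk_length_eq_dist u v
  rw [← hp, ← SimpleGraph.Walk.length_map g.toHom p]
  exact SimpleGraph.dist_le _

lemma pathDist_smul_le (hT : T.IsTree) (g : T ≃g T) (x y : Realisation T) :
    pathDist (g • x) (g • y) ≤ pathDist x y := by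
  by_cases hc : OnCommonEdge x y
  · obtain ⟨a, b, hab, hx, hy⟩ := hc
    have hx' : ((g • x).coord.support : Set V) ⊆ {g a, g b} := by
      intro z hz
      obtain ⟨z, rfl⟩ := g.surjective z
      rw [SetLike.mem_coe, mem_support_smul] at hz
      rcases hx hz with h | h <;> rw [h] <;> simp
    have hy' : ((g • y).coord.support : Set V) ⊆ {g a, g b} := by
      intro z hz
      obtain ⟨z, rfl⟩ := g.surjective z
      rw [SetLike.mem_coe, mem_support_smul] at hz
      rcases hy hz with h | h <;> rw [h] <;> simp
    rw [pathDist_of_edge hab hx hy, pathDist_of_edge (g.map_rel_iff.2 hab) hx' hy', coord_smul,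
      coord_smul]
  · have hc' : ¬ OnCommonEdge (g • x) (g • y) := fun h => hc (by
      simpa using onCommonEdge_smul g⁻¹ h)
    obtain ⟨u, hu, w, hw, h⟩ := exists_pathDist_eq hc
    have := pathDist_le hc' ((mem_support_smul g x u).2 hu) ((mem_support_smul g y w).2 hw)
    rw [coord_smul, coord_smul] at this
    have h2 : (T.dist (g u) (g w) : ℝ) ≤ T.dist u w := by exact_mod_cast dist_map_le hT g u w
    linarith

lemma continuous_smul [hT : Fact T.IsTree] (g : T ≃g T) :
    Continuous fun x : Realisation T => g • x :=
  (LipschitzWith.of_dist_le_mul (K := 1) fun x y => by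
    rw [NNReal.coe_one, one_mul]; exact pathDist_smul_le hT.out g x y).continuous

end Realisation

variable {V : Type*} {T : SimpleGraph V}

/-- The self-map of the geometric realisation induced by an automorphism. -/
noncomputable def realisationMap [Fact T.IsTree] (g : T ≃g T) :
    C(Realisation T, Realisation T) where
  toFun x := g • x
  continuous_toFun := Realisation.continuous_smul g

/-- The compact-open topology on the automorphism group of a tree. -/
noncomputable instance compactOpen [Fact T.IsTree] : TopologicalSpace (T ≃g T) :=
  TopologicalSpace.induced realisationMap ContinuousMap.compactOpen

/-- The translation length: the least displacement of a point of the geometric realisation. -/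
noncomputable def translationLength [Fact T.IsTree] (g : T ≃g T) : ℝ :=
  ⨅ x : Realisation T, dist x (g • x)

/-- An automorphism is hyperbolic if its translation length is positive (otherwise it is elliptic;
so inversions are elliptic). -/
def IsHyperbolic [Fact T.IsTree] (g : T ≃g T) : Prop :=
  0 < translationLength g

/-- A group of automorphisms is purely hyperbolic if all its nontrivial elements are hyperbolic. -/
def IsPurelyHyperbolic [Fact T.IsTree] (G : Subgroup (T ≃g T)) : Prop :=
  ∀ g ∈ G, g ≠ 1 → IsHyperbolic g

end TreeAut

/-! ### Vertices, supports and distances under the action on the realisation -/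

namespace TreeAut

namespace Realisation

variable {V : Type*} {T : SimpleGraph V}

/-! Elliptic elements are controlled by vertices: if `g` moves points by arbitrarily little then, a
tree being bipartite, `g ^ 2` fixes a vertex (`exists_apply_apply_eq_of_not_isHyperbolic`). In a
locally finite tree `g ^ 2` permutes the finite balls about that vertex, so a positive power of it
fixes any given ball pointwise. Discreteness makes such a power trivial, and a free group has no
torsion.

Conversely, in a purely hyperbolic group vertex stabilisers are trivial, and evaluation at a vertex
is locally constant; this gives discreteness. There are also no involutions, since an involution of
a tree fixes a vertex or the midpoint of an edge. Freeness is then a combinatorial covering-space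
argument. A subtree `S` meeting every orbit once (`exists_subtree_transversal`) has translates that
tile the vertices. The nontrivial elements carrying `S` to an adjacent tile, one from each inverse
pair, are free generators: a tree has no cycles, so the labels of crossed edges integrate to a
potential with values in the free group (`exists_potential`). Its equivariance turns it into an
inverse of the evaluation map to `G`. -/

lemma smul_vertex (g : T ≃g T) (v : V) : g • vertex T v = vertex T (g v) :=
  Realisation.ext (by
    change Finsupp.equivMapDomain g.toEquiv (Finsupp.single v 1) = _
    rw [Finsupp.equivMapDomain_single]; rfl)

lemma dist_map (hT : T.IsTree) (g : T ≃g T) (u v : V) : T.dist (g u) (g v) = T.dist u v := by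
  refine le_antisymm (dist_map_le hT g u v) ?_
  simpa [← RelIso.mul_apply] using dist_map_le hT g⁻¹ (g u) (g v)

lemma smul_eq_self_of_forall_mem_support {g : T ≃g T} {x : Realisation T}
    (h : ∀ u ∈ x.coord.support, g u = u) : g • x = x := by
  ext w
  obtain ⟨u, rfl⟩ := g.surjective w
  rw [coord_smul]
  by_cases hu : u ∈ x.coord.support
  · rw [h u hu]
  · have hgu : g u ∉ x.coord.support := fun hgu => hu (by rwa [g.injective (h _ hgu)] at hgu)
    rw [Finsupp.notMem_support_iff.1 hu, Finsupp.notMem_support_iff.1 hgu]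

variable [hT : Fact T.IsTree]

lemma dist_smul_le (g : T ≃g T) (x y : Realisation T) : dist (g • x) (g • y) ≤ dist x y :=
  pathDist_smul_le hT.out g x y

lemma dist_vertex_eq (x : Realisation T) {u : V} (hu : u ∈ x.coord.support) :
    dist x (vertex T u) = 1 - x.coord u := by
  rcases x.coord_cases hu with h | ⟨u', hadj, -, -, hs⟩
  · rw [h, show x = vertex T u from Realisation.ext h, dist_self]
    simp
  · change pathDist _ _ = _
    have e : (vertex T u).coord = Finsupp.single u 1 := rfl
    rw [pathDist_of_edge hadj hs.subset (by
      rw [e, Finsupp.support_single u one_ne_zero]; simp), e, Finsupp.single_eq_same, abs_sub_comm,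
      abs_of_nonneg (by linarith [x.coord_le_one u])]

/-- Every point is within distance `1 / 2` of some vertex. -/
lemma exists_dist_vertex_le (x : Realisation T) : ∃ u, dist x (vertex T u) ≤ 1 / 2 := by
  obtain ⟨u, hu⟩ := x.exists_mem_support
  rcases x.coord_cases hu with h | ⟨u', hadj, hu', hs, -⟩
  · exact ⟨u, by rw [dist_vertex_eq x hu, h]; norm_num⟩
  · rcases le_total (x.coord u) (x.coord u') with hle | hle
    · exact ⟨u', by rw [dist_vertex_eq x hu']; linarith⟩
    · exact ⟨u, by rw [dist_vertex_eq x hu]; linarith⟩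

end Realisation

/-! ### Elliptic automorphisms and discrete free groups -/

open Realisation

variable {V : Type*} {T : SimpleGraph V}

lemma pow_apply_eq {g : T ≃g T} {v : V} (h : g v = v) (n : ℕ) : (g ^ n) v = v := by
  induction n with
  | zero => rfl
  | succ n ih => rw [pow_succ, RelIso.mul_apply, h, ih]

/-- A geodesic to `r` passes through a neighbour one step closer, so each ball lies in the previous
one together with finitely many finite neighbour sets. -/
lemma finite_setOf_dist_le (hT : T.IsTree) (hfin : ∀ v, (T.neighborSet v).Finite) (r : V)
    (n : ℕ) : {v | T.dist r v ≤ n}.Finite := by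
  induction n with
  | zero =>
    refine (Set.finite_singleton r).subset fun v hv => ?_
    exact (hT.connected.dist_eq_zero_iff.1 (Nat.le_zero.1 hv)).symm
  | succ n ih =>
    refine (ih.union (ih.biUnion fun v _ => hfin v)).subset fun v hv => ?_
    rcases Nat.lt_or_ge n (T.dist r v) with h | h
    · obtain ⟨p, hp⟩ := hT.connected.exists_walk_length_eq_dist v r
      have hne : ¬ p.Nil := by
        rw [← SimpleGraph.Walk.length_eq_zero_iff, hp, T.dist_comm]; omega
      refine Or.inr (Set.mem_biUnion (x := p.snd) ?_ (p.adj_snd hne).symm)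
      have h1 := SimpleGraph.dist_le p.tail
      have h2 := SimpleGraph.Walk.length_tail_add_one hne
      have h3 : T.dist r v ≤ n + 1 := hv
      rw [T.dist_comm] at h1 h3
      change T.dist r p.snd ≤ n
      omega
    · exact Or.inl h

variable [hT : Fact T.IsTree]

lemma translationLength_le (g : T ≃g T) (x : Realisation T) :
    translationLength g ≤ dist x (g • x) :=
  ciInf_le ⟨0, by rintro _ ⟨y, rfl⟩; exact dist_nonneg⟩ x

lemma IsHyperbolic.smul_ne {g : T ≃g T} (hg : IsHyperbolic g) (x : Realisation T) :
    g • x ≠ x := fun h => by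
  have := translationLength_le g x
  rw [h, dist_self] at this
  exact absurd hg this.not_gt

lemma IsHyperbolic.apply_ne {g : T ≃g T} (hg : IsHyperbolic g) (v : V) : g v ≠ v := fun h =>
  hg.smul_ne (vertex T v) (by rw [smul_vertex, h])

/-- A hyperbolic automorphism does not invert an edge. -/
lemma IsHyperbolic.not_inverts {g : T ≃g T} (hg : IsHyperbolic g) {u v : V} (huv : T.Adj u v)
    (h1 : g u = v) (h2 : g v = u) : False := by
  classical
  have hs : ∀ w ∈ (Finsupp.single u (1 / 2 : ℝ) + Finsupp.single v (1 / 2)).support,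
      w = u ∨ w = v := by
    intro w hw
    by_contra! hne
    simp [hne.1.symm, hne.2.symm] at hw
  -- The midpoint of the edge: `g` swaps its two equal weights.
  let x : Realisation T :=
    { coord := Finsupp.single u (1 / 2) + Finsupp.single v (1 / 2)
      nonneg := fun w => by
        simp only [Finsupp.add_apply, Finsupp.single_apply]
        split_ifs <;> norm_num
      sum_eq_one := by
        rw [Finsupp.sum_add_index' (by simp) (by simp), Finsupp.sum_single_index rfl,
          Finsupp.sum_single_index rfl]
        norm_num
      card_support_le := (Finset.card_le_card (t := {u, v}) fun w hw => by
        simpa using hs w hw).trans Finset.card_le_two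
      adj_of_mem := fun a ha b hb hab => by
        rcases hs a ha with rfl | rfl <;> rcases hs b hb with rfl | rfl
        exacts [absurd rfl hab, huv, huv.symm, absurd rfl hab] }
  refine hg.smul_ne x (Realisation.ext ?_)
  change Finsupp.equivMapDomain g.toEquiv (Finsupp.single u (1 / 2) + Finsupp.single v (1 / 2)) = _
  ext w
  obtain ⟨w, rfl⟩ := g.surjective w
  rw [Finsupp.equivMapDomain_apply]
  have e : g.toEquiv.symm (g w) = w := g.toEquiv.symm_apply_apply w
  change _ = (Finsupp.single u (1 / 2) + Finsupp.single v (1 / 2) : V →₀ ℝ) (g w)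
  have e1 : u = g w ↔ v = w := by rw [← h2, g.injective.eq_iff]
  have e2 : v = g w ↔ u = w := by
    constructor
    · intro h; exact g.injective (h1.trans h)
    · rintro rfl; exact h1.symm
  simp only [e, Finsupp.add_apply, Finsupp.single_apply, e1, e2]
  rw [add_comm]

/-- The square of an elliptic automorphism fixes a vertex. -/
lemma exists_apply_apply_eq_of_not_isHyperbolic {g : T ≃g T} (hg : ¬ IsHyperbolic g) :
    ∃ v, g (g v) = v := by
  obtain ⟨v₀⟩ := hT.out.connected.nonempty
  have : Nonempty (Realisation T) := ⟨vertex T v₀⟩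
  -- The infimum need not be attained. A vertex within 1/2 of a point moved by less than 1/4 is
  -- moved by less than 5/4 under `g` and less than 3/2 under `g ^ 2`, so both integer displacements
  -- are at most 1.
  obtain ⟨x, hx⟩ := exists_lt_of_ciInf_lt
    (lt_of_le_of_lt (not_lt.1 hg) (by norm_num : (0 : ℝ) < 1 / 4))
  obtain ⟨v, hv⟩ := x.exists_dist_vertex_le
  have hgx := dist_smul_le g x (g • x)
  have hgv := dist_smul_le g x (vertex T v)
  have hggv := dist_smul_le g (g • x) (g • vertex T v)
  have h1 : dist (vertex T v) (vertex T (g v)) < 2 := by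
    rw [← smul_vertex]
    have := dist_triangle4 (vertex T v) x (g • x) (g • vertex T v)
    rw [dist_comm _ x] at this
    linarith
  have h2 : dist (vertex T v) (vertex T (g (g v))) < 2 := by
    rw [← smul_vertex, ← smul_vertex]
    have := dist_triangle4 (vertex T v) x (g • g • x) (g • g • vertex T v)
    rw [dist_comm _ x] at this
    linarith [dist_triangle x (g • x) (g • g • x)]
  rw [dist_vertex] at h1 h2
  have h1 : T.dist v (g v) < 2 := by exact_mod_cast h1
  have h2 : T.dist v (g (g v)) < 2 := by exact_mod_cast h2
  refine ⟨v, ?_⟩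
  rcases Nat.eq_zero_or_pos (T.dist v (g v)) with h | h
  · have := hT.out.connected.dist_eq_zero_iff.1 h
    rw [← this, ← this]
  · have h3 : T.dist v (g v) = 1 := by omega
    have hadj : T.Adj (g v) (g (g v)) := g.map_rel_iff.2 (SimpleGraph.dist_eq_one_iff_adj.1 h3)
    -- Distances from `v` to adjacent vertices differ by exactly 1, so this one is 0 or 2, and 2 is
    -- excluded.
    have h4 : T.dist v (g (g v)) = 0 := by
      rcases hT.out.dist_eq_dist_add_one_of_adj v hadj with h | h <;> omega
    exact (hT.out.connected.dist_eq_zero_iff.1 h4).symm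

/-- In a discrete group of automorphisms, an element fixing a sufficiently large ball pointwise is
trivial. -/
lemma exists_eq_one_of_forall_dist_le (G : Subgroup (T ≃g T)) [DiscreteTopology G] (r : V) :
    ∃ n : ℕ, ∀ g ∈ G, (∀ u, T.dist r u ≤ n → g u = u) → g = 1 := by
  have h1 : IsOpen ({1} : Set G) := isOpen_discrete _
  obtain ⟨A, hA, hA1⟩ := isOpen_induced_iff.1 h1
  obtain ⟨B, hB, rfl⟩ := isOpen_induced_iff.1 hA
  have h1B : realisationMap (1 : T ≃g T) ∈ B := by
    have : (1 : G) ∈ (Subtype.val : G → T ≃g T) ⁻¹' (realisationMap ⁻¹' B) := by rw [hA1]; rfl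
    exact this
  obtain ⟨F, ⟨hF, hFK⟩, hFB⟩ := (ContinuousMap.hasBasis_nhds _).mem_iff.1 (hB.mem_nhds h1B)
  -- A basic neighbourhood of the identity constrains maps on finitely many compact sets only, hence
  -- on a bounded region.
  have hbdd : Bornology.IsBounded (⋃ p ∈ F, p.1) :=
    (Bornology.isBounded_biUnion hF).2 fun p hp => (hFK p.1 p.2 hp).1.isBounded
  obtain ⟨R, hR⟩ := hbdd.subset_closedBall (vertex T r)
  -- The extra 1 covers the vertices carrying a point of the region, each within distance 1 of it.
  obtain ⟨n, hn⟩ := exists_nat_ge (R + 1)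
  refine ⟨n, fun g hg hfix => ?_⟩
  suffices h : (⟨g, hg⟩ : G) ∈ ({1} : Set G) from congrArg Subtype.val h
  rw [← hA1]
  refine hFB (Set.mem_iInter₂.2 fun p hp x hx => ?_)
  have hgx : g • x = x := smul_eq_self_of_forall_mem_support fun u hu => hfix u ?_
  · change g • x ∈ p.2
    rw [hgx]
    have := (hFK p.1 p.2 hp).2.2 hx
    change (1 : T ≃g T) • x ∈ p.2 at this
    rwa [one_smul] at this
  · have h2 : dist x (vertex T r) ≤ R := hR (Set.mem_biUnion hp hx)
    have h3 := dist_vertex_eq x hu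
    have h4 := dist_triangle (vertex T r) x (vertex T u)
    rw [dist_vertex, dist_comm _ x] at h4
    have h5 := x.nonneg u
    have h6 : (T.dist r u : ℝ) ≤ n := by linarith
    exact_mod_cast h6

/-- An automorphism fixing a vertex of a locally finite tree has a power fixing a given ball
pointwise. -/
lemma exists_pow_apply_eq (hfin : ∀ v, (T.neighborSet v).Finite) {g : T ≃g T} {r : V}
    (hr : g r = r) (n : ℕ) : ∃ k, k ≠ 0 ∧ ∀ u, T.dist r u ≤ n → (g ^ k) u = u := by
  have := (finite_setOf_dist_le hT.out hfin r n).to_subtype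
  let B := {v | T.dist r v ≤ n}
  have hmaps (m : ℕ) (u : B) : (g ^ m) u ∈ B := by
    have := dist_map hT.out (g ^ m) r u
    rw [pow_apply_eq hr] at this
    exact this.le.trans u.2
  -- Pigeonhole: a finite ball has only finitely many self-maps.
  obtain ⟨a, b, hab, he⟩ := Finite.exists_ne_map_eq_of_infinite
    fun (m : ℕ) (u : B) => (⟨(g ^ m) u, hmaps m u⟩ : B)
  wlog hlt : a < b generalizing a b
  · exact this b a hab.symm he.symm (by omega)
  refine ⟨b - a, by omega, fun u hu => (g ^ a).injective ?_⟩
  have h := congrArg Subtype.val (congrFun he ⟨u, hu⟩)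
  rw [← RelIso.mul_apply, ← pow_add, Nat.add_sub_cancel' hlt.le]
  exact h.symm

/-- In a locally finite tree, discrete free groups of automorphisms are purely hyperbolic. -/
theorem isPurelyHyperbolic_of_discreteTopology (hfin : ∀ v, (T.neighborSet v).Finite)
    (G : Subgroup (T ≃g T)) [DiscreteTopology G] [IsFreeGroup G] : IsPurelyHyperbolic G := by
  intro g hg hne
  by_contra hell
  obtain ⟨v, hv⟩ := exists_apply_apply_eq_of_not_isHyperbolic hell
  obtain ⟨n, hn⟩ := exists_eq_one_of_forall_dist_le G v
  -- The square is needed because `g` itself may invert an edge.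
  have hv' : (g ^ 2) v = v := by rwa [pow_two, RelIso.mul_apply]
  obtain ⟨k, hk, hfix⟩ := exists_pow_apply_eq hfin hv' n
  have h1 := hn _ (pow_mem (pow_mem hg 2) k) hfix
  rw [← pow_mul] at h1
  have h2 : (IsFreeGroup.toFreeGroup G ⟨g, hg⟩) ^ (2 * k) = 1 := by
    rw [← map_pow, map_eq_one_iff _ (MulEquiv.injective _)]
    exact Subtype.ext h1
  have h3 := IsMulTorsionFree.pow_left_injective (n := 2 * k) (by omega)
    (h2.trans (one_pow (2 * k)).symm)
  rw [map_eq_one_iff _ (MulEquiv.injective _)] at h3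
  exact hne (congrArg Subtype.val h3)

/-! ### Discreteness of purely hyperbolic groups -/

/-- Purely hyperbolic groups of automorphisms are discrete. -/
theorem IsPurelyHyperbolic.discreteTopology {G : Subgroup (T ≃g T)} (hG : IsPurelyHyperbolic G) :
    DiscreteTopology G := by
  obtain ⟨v⟩ := hT.out.connected.nonempty
  refine discreteTopology_iff_isOpen_singleton.2 fun g => ?_
  -- An open ball of radius 1 about a vertex contains no other vertex, so this open condition
  -- prescribes the image of `v` exactly.
  have ho : IsOpen {f : C(Realisation T, Realisation T) |
      Set.MapsTo f {vertex T v} (Metric.ball (vertex T ((g : T ≃g T) v)) 1)} :=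
    ContinuousMap.isOpen_setOfPred_mapsTo isCompact_singleton Metric.isOpen_ball
  have ho' : IsOpen {h : T ≃g T | h v = (g : T ≃g T) v} := by
    refine isOpen_induced_iff.2 ⟨_, ho, ?_⟩
    ext h
    have : realisationMap h (vertex T v) = vertex T (h v) := smul_vertex h v
    change Set.MapsTo (realisationMap h) _ _ ↔ h v = (g : T ≃g T) v
    rw [Set.mapsTo_singleton, this, Metric.mem_ball, dist_vertex, Nat.cast_lt_one,
      hT.out.connected.dist_eq_zero_iff]
  refine isOpen_induced_iff.2 ⟨_, ho', ?_⟩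
  ext h
  constructor
  · intro hh
    have hh : (h : T ≃g T) v = (g : T ≃g T) v := hh
    by_contra hne
    refine (hG ((g⁻¹ * h : G) : T ≃g T) (g⁻¹ * h).2 fun h1 => hne ?_).apply_ne v ?_
    · exact (inv_mul_eq_one.1 (Subtype.ext h1 : g⁻¹ * h = 1)).symm
    · rw [Subgroup.coe_mul, RelIso.mul_apply, hh, ← RelIso.mul_apply, ← Subgroup.coe_mul,
        inv_mul_cancel]
      rfl
  · rintro rfl
    rfl

end TreeAut

/-! ### Rooted trees: potentials, involutions and transversals -/

namespace TreeAut

open Realisation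

variable {V : Type*} {T : SimpleGraph V}

/-- In a tree rooted at `r`, every other vertex has a parent. -/
lemma exists_parent (hT : T.IsTree) {r v : V} (hv : v ≠ r) :
    ∃ u, T.Adj u v ∧ T.dist r v = T.dist r u + 1 := by
  obtain ⟨p, hp⟩ := hT.connected.exists_walk_length_eq_dist v r
  have hne : ¬ p.Nil := fun h => hv h.eq
  have h1 := SimpleGraph.dist_le p.tail
  have h2 := SimpleGraph.Walk.length_tail_add_one hne
  have hadj := p.adj_snd hne
  refine ⟨p.snd, hadj.symm, ?_⟩
  rw [T.dist_comm] at h1 hp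
  rcases hT.dist_eq_dist_add_one_of_adj r hadj with h | h <;> omega

/-- Induction along a rooted tree. -/
lemma induction_from_root (hT : T.IsTree) (r : V) {p : V → Prop} (h0 : p r)
    (h1 : ∀ u v, T.Adj u v → p u → p v) (v : V) : p v := by
  induction hn : T.dist r v generalizing v with
  | zero => rwa [← hT.connected.dist_eq_zero_iff.1 hn]
  | succ n ih =>
    have hv : v ≠ r := by rintro rfl; simp at hn
    obtain ⟨u, hadj, hu⟩ := exists_parent hT hv
    exact h1 u v hadj (ih u (by omega))

/-- On a tree, every antisymmetric group-valued function on the oriented edges has a potential. -/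
lemma exists_potential (hT : T.IsTree) {H : Type*} [Group H] (r : V) (c : V → V → H)
    (hc : ∀ u v, c v u = (c u v)⁻¹) :
    ∃ φ : V → H, φ r = 1 ∧ ∀ u v, T.Adj u v → φ v = φ u * c u v := by
  have hp : ∀ v, ∃ u, v ≠ r → T.Adj u v ∧ T.dist r v = T.dist r u + 1 := fun v => by
    by_cases hv : v = r
    · exact ⟨r, fun h => absurd hv h⟩
    · obtain ⟨u, hu⟩ := exists_parent hT hv
      exact ⟨u, fun _ => hu⟩
  choose p hp using hp
  -- The product of `c` along the first `n` steps up the chain of parents; at `n = T.dist r v` the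
  -- chain has just reached the root.
  let Φ : ℕ → V → H := fun n =>
    Nat.rec (fun _ => 1) (fun _ f v => f (p v) * c (p v) v) n
  have key : ∀ u v, T.Adj u v → T.dist r v = T.dist r u + 1 →
      Φ (T.dist r v) v = Φ (T.dist r u) u * c u v := by
    intro u v hadj hd
    have hv : v ≠ r := by rintro rfl; simp at hd
    have hu : p v = u := neighbour_unique hT (hp v hv).1.symm hadj.symm (hp v hv).2 hd
    rw [hd]
    change Φ (T.dist r u) (p v) * c (p v) v = _
    rw [hu]
  refine ⟨fun v => Φ (T.dist r v) v, by simp [Φ], fun u v hadj => ?_⟩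
  rcases hT.dist_eq_dist_add_one_of_adj r hadj with h | h
  · beta_reduce
    rw [key v u hadj.symm h, hc u v, inv_mul_cancel_right]
  · exact key u v hadj h

/-- An involution of a tree fixes a vertex or inverts an edge. -/
lemma exists_fixed_or_inverted_of_involutive (hT : T.IsTree) (g : T ≃g T)
    (hg : ∀ v, g (g v) = v) : ∃ v, g v = v ∨ T.Adj v (g v) := by
  obtain ⟨v₀⟩ := hT.connected.nonempty
  -- Descent on the displacement: if it exceeds 1, moving both ends one step inwards along the
  -- geodesic from `v₀` to `g v₀` lowers it by 2.
  induction hn : T.dist v₀ (g v₀) using Nat.strong_induction_on generalizing v₀ with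
  | _ n ih =>
    by_cases h0 : g v₀ = v₀
    · exact ⟨v₀, Or.inl h0⟩
    obtain ⟨w, hw, hd⟩ := exists_parent hT h0
    by_cases h1 : w = v₀
    · exact ⟨v₀, Or.inr (h1 ▸ hw)⟩
    have hgw : T.Adj v₀ (g w) := by
      have := g.map_rel_iff.2 hw
      rw [hg] at this
      exact this.symm
    have e1 : T.dist (g v₀) v₀ = T.dist (g v₀) (g w) + 1 := by
      rw [dist_map hT, T.dist_comm, hd]
    -- the neighbour of `v₀` towards `w` is the neighbour towards `g v₀`
    obtain ⟨s, hs, hds⟩ := exists_parent (r := w) hT (Ne.symm h1)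
    have e2 : T.dist (g v₀) w = 1 := SimpleGraph.dist_eq_one_iff_adj.2 hw.symm
    have e3 : T.dist (g v₀) s ≤ T.dist (g v₀) w + T.dist w s := hT.connected.dist_triangle
    have e5 : T.dist v₀ w = T.dist w v₀ := T.dist_comm
    have e6 : T.dist v₀ (g v₀) = T.dist (g v₀) v₀ := T.dist_comm
    have e4 : T.dist (g v₀) v₀ = T.dist (g v₀) s + 1 := by
      rcases hT.dist_eq_dist_add_one_of_adj (g v₀) hs with h | h <;> omega
    have hsw : s = g w := neighbour_unique hT hs.symm hgw e4 e1
    refine ih (T.dist w (g w)) ?_ w rfl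
    rw [← hsw]
    omega

/-- The action of a group of automorphisms on the vertices of a tree has a transversal which is a
subtree. -/
lemma exists_subtree_transversal (hT : T.IsTree) (G : Subgroup (T ≃g T)) (r : V) :
    ∃ S : Set V, r ∈ S ∧
      (∀ v ∈ S, v ≠ r → ∃ u ∈ S, T.Adj u v ∧ T.dist r v = T.dist r u + 1) ∧
      (∀ u ∈ S, ∀ v ∈ S, ∀ g ∈ G, g u = v → u = v) ∧ ∀ v, ∃ g ∈ G, ∃ s ∈ S, g s = v := by
  -- Partial transversals that are closed under parents; a maximal one is shown to meet every orbit.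
  let F : Set (Set V) := {S | r ∈ S ∧
      (∀ v ∈ S, v ≠ r → ∃ u ∈ S, T.Adj u v ∧ T.dist r v = T.dist r u + 1) ∧
      (∀ u ∈ S, ∀ v ∈ S, ∀ g ∈ G, g u = v → u = v)}
  obtain ⟨S, -, hS⟩ := zorn_subset_nonempty F (by
    intro c hcF hc hne
    refine ⟨⋃₀ c, ⟨?_, ?_, ?_⟩, fun s hs => Set.subset_sUnion_of_mem hs⟩
    · obtain ⟨s, hs⟩ := hne
      exact ⟨s, hs, (hcF hs).1⟩
    · rintro v ⟨s, hs, hv⟩ hvr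
      obtain ⟨u, hu, h⟩ := (hcF hs).2.1 v hv hvr
      exact ⟨u, ⟨s, hs, hu⟩, h⟩
    · rintro u ⟨s, hs, hu⟩ v ⟨t, ht, hv⟩ g hg h
      rcases hc.total hs ht with hst | hst
      · exact (hcF ht).2.2 u (hst hu) v hv g hg h
      · exact (hcF hs).2.2 u hu v (hst hv) g hg h) {r} (by
    refine ⟨rfl, fun v hv hvr => absurd hv hvr, ?_⟩
    rintro u rfl v rfl _ _ _
    rfl)
  obtain ⟨hr, hpar, hinj⟩ := hS.prop
  refine ⟨S, hr, hpar, hinj, induction_from_root hT r ⟨1, one_mem G, r, hr, rfl⟩ ?_⟩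
  rintro _ b hadj ⟨g, hg, s, hs, rfl⟩
  by_contra hb
  -- An uncovered neighbour of a translate of `S` is moved back next to `S` itself.
  have hadj' : T.Adj s (g⁻¹ b) := by
    have := (g⁻¹).map_rel_iff.2 hadj
    rwa [← RelIso.mul_apply, inv_mul_cancel] at this
  have hb' : ∀ k ∈ G, ∀ t ∈ S, k t ≠ g⁻¹ b := fun k hk t ht h => hb
    ⟨g * k, mul_mem hg hk, t, ht, by
      rw [RelIso.mul_apply, h, ← RelIso.mul_apply, mul_inv_cancel]; rfl⟩
  have hbS : g⁻¹ b ∉ S := fun h => hb' 1 (one_mem G) _ h rfl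
  -- If the new vertex is closer to `r` it is the parent of `s`, already in `S`; otherwise it can be
  -- adjoined, against maximality.
  rcases hT.dist_eq_dist_add_one_of_adj r hadj' with h | h
  · have hsr : s ≠ r := by rintro rfl; simp at h
    obtain ⟨u, hu, hadju, hdu⟩ := hpar s hs hsr
    exact hbS (neighbour_unique hT hadju.symm hadj' hdu h ▸ hu)
  · have hmem : insert (g⁻¹ b) S ∈ F := by
      refine ⟨Or.inr hr, ?_, ?_⟩
      · rintro v (rfl | hv) hvr
        · exact ⟨s, Or.inr hs, hadj', h⟩
        · obtain ⟨u, hu, h⟩ := hpar v hv hvr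
          exact ⟨u, Or.inr hu, h⟩
      · rintro u (rfl | hu) v (rfl | hv) k hk hkuv
        · rfl
        · refine absurd ?_ (hb' k⁻¹ (inv_mem hk) v hv)
          rw [← hkuv, ← RelIso.mul_apply, inv_mul_cancel]; rfl
        · exact absurd hkuv (hb' k hk u hu)
        · exact hinj u hu v hv k hk hkuv
    exact hbS (hS.le_of_ge hmem (Set.subset_insert _ _) (Set.mem_insert _ _))

/-! ### Freeness from a free action without involutions -/

open Classical in
/-- The word of length at most one representing `x`, with respect to a set `P` of generators
containing at most one of `x` and `x⁻¹`. -/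
noncomputable def letter {G : Type*} [Group G] (P : Set G) (x : G) : FreeGroup P :=
  if h : x ∈ P then FreeGroup.of ⟨x, h⟩
  else if h : x⁻¹ ∈ P then (FreeGroup.of ⟨x⁻¹, h⟩)⁻¹ else 1

/-- Supplies the antisymmetry required by `exists_potential`; `hP` keeps the two nontrivial branches
of `letter` exclusive. -/
lemma letter_inv {G : Type*} [Group G] {P : Set G} (hP : ∀ x ∈ P, x⁻¹ ∉ P) (x : G) :
    letter P x⁻¹ = (letter P x)⁻¹ := by
  by_cases h1 : x ∈ P
  · have h2 := hP x h1
    simp [letter, h1, h2]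
  · by_cases h2 : x⁻¹ ∈ P <;> simp [letter, h1, h2]

/-- The default value of `letter` is correct only at the identity, whence the third alternative. -/
lemma lift_letter {G : Type*} [Group G] {P : Set G} {x : G} (hx : x ∈ P ∨ x⁻¹ ∈ P ∨ x = 1) :
    FreeGroup.lift ((↑) : P → G) (letter P x) = x := by
  by_cases h1 : x ∈ P
  · simp [letter, h1]
  · by_cases h2 : x⁻¹ ∈ P
    · simp [letter, h1, h2]
    · obtain rfl : x = 1 := by tauto
      simp only [inv_one] at h2
      simp [letter, h2]

/-- A group of automorphisms of a tree acting freely on the vertices and without involutions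
is free. -/
theorem isFreeGroup_of_free_action (hT : T.IsTree) (G : Subgroup (T ≃g T))
    (hfree : ∀ g ∈ G, ∀ v, g v = v → g = 1) (hinv : ∀ g ∈ G, g⁻¹ = g → g = 1) :
    IsFreeGroup G := by
  obtain ⟨r⟩ := hT.connected.nonempty
  obtain ⟨S, hr, hpar, hinj, hcov⟩ := exists_subtree_transversal hT G r
  have hcov : ∀ v, ∃ g : G, ∃ s ∈ S, (g : T ≃g T) s = v := fun v => by
    obtain ⟨g, hg, h⟩ := hcov v
    exact ⟨⟨g, hg⟩, h⟩
  -- `γ v` names the tile containing `v`, and `σ v` is the representative of its orbit in `S`.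
  choose γ σ hσ hγ using hcov
  have huniq (g h : G) (s t : V) (hs : s ∈ S) (ht : t ∈ S)
      (e : (g : T ≃g T) s = (h : T ≃g T) t) : g = h := by
    have e1 : ((h⁻¹ * g : G) : T ≃g T) s = t := by
      rw [Subgroup.coe_mul, RelIso.mul_apply, e, ← RelIso.mul_apply, ← Subgroup.coe_mul,
        inv_mul_cancel]
      rfl
    obtain rfl := hinj s hs t ht _ (h⁻¹ * g).2 e1
    have e2 : h⁻¹ * g = 1 := Subtype.ext (hfree _ (h⁻¹ * g).2 s e1)
    exact (inv_mul_eq_one.1 e2).symm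
  have hγS (g : G) (s : V) (hs : s ∈ S) : γ ((g : T ≃g T) s) = g :=
    huniq _ _ _ _ (hσ _) hs (hγ _)
  have hγr : γ r = 1 := hγS 1 r hr
  have hγmul (g : G) (v : V) : γ ((g : T ≃g T) v) = g * γ v := by
    conv_lhs => rw [← hγ v]
    rw [← RelIso.mul_apply, ← Subgroup.coe_mul, hγS _ _ (hσ v)]
  -- a generator from each pair of inverse labels of edges
  let P : Set G := {x | WellOrderingRel x x⁻¹ ∧ ∃ s ∈ S, ∃ t ∈ S, T.Adj s ((x : T ≃g T) t)}
  have hP : ∀ x ∈ P, x⁻¹ ∉ P := fun x hx hx' => by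
    have := hx'.1
    rw [inv_inv] at this
    exact asymm hx.1 this
  let L : FreeGroup P →* G := FreeGroup.lift ((↑) : P → G)
  -- The label of an edge depends only on the relative position of the two tiles, so it is invariant
  -- under `G`.
  let c : V → V → FreeGroup P := fun u v => letter P ((γ u)⁻¹ * γ v)
  have hc (u v : V) : c v u = (c u v)⁻¹ := by
    rw [← letter_inv hP, mul_inv_rev, inv_inv]
  have hcG (g : G) (u v : V) : c ((g : T ≃g T) u) ((g : T ≃g T) v) = c u v := by
    simp only [c, hγmul, mul_inv_rev, mul_assoc, inv_mul_cancel_left]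
  have hLc (u v : V) (hadj : T.Adj u v) : L (c u v) = (γ u)⁻¹ * γ v := by
    have hmove (a b : V) (hab : T.Adj a b) :
        ∃ s ∈ S, ∃ t ∈ S, T.Adj s ((((γ a)⁻¹ * γ b : G) : T ≃g T) t) := by
      refine ⟨σ a, hσ a, σ b, hσ b, ?_⟩
      have h1 : T.Adj ((γ a : T ≃g T)⁻¹ a) ((γ a : T ≃g T)⁻¹ b) := RelIso.map_rel_iff _ |>.2 hab
      have h2 : (γ a : T ≃g T)⁻¹ a = σ a :=
        (congrArg _ (hγ a).symm).trans (RelIso.inv_apply_self _ _)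
      rwa [h2, ← Subgroup.coe_inv, ← hγ b, ← RelIso.mul_apply, ← Subgroup.coe_mul] at h1
    apply lift_letter
    by_cases h1 : (γ u)⁻¹ * γ v = 1
    · exact Or.inr (Or.inr h1)
    have h2 : ((γ u)⁻¹ * γ v)⁻¹ = (γ v)⁻¹ * γ u := by rw [mul_inv_rev, inv_inv]
    rcases trichotomous_of WellOrderingRel ((γ u)⁻¹ * γ v) ((γ u)⁻¹ * γ v)⁻¹ with h | h | h
    · exact Or.inl ⟨h, hmove u v hadj⟩
    -- A label equal to its inverse could not be selected by the order; the absence of involutions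
    -- forces it to be `1`.
    · exact absurd (Subtype.ext (hinv _ ((γ u)⁻¹ * γ v).2 (congrArg Subtype.val h.symm))) h1
    · refine Or.inr (Or.inl ⟨by rwa [inv_inv], ?_⟩)
      rw [h2]
      exact hmove v u hadj.symm
  obtain ⟨φ, hφr, hφ⟩ := exists_potential hT r c hc
  -- Both sides agree at `r` and, by invariance of `c`, have the same increment along every edge.
  have hφmul (g : G) (v : V) : φ ((g : T ≃g T) v) = φ ((g : T ≃g T) r) * φ v := by
    refine induction_from_root hT r (p := fun v => φ ((g : T ≃g T) v) = φ ((g : T ≃g T) r) * φ v)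
      ?_ (fun u v hadj hu => ?_) v
    · rw [hφr, mul_one]
    · rw [hφ _ _ ((g : T ≃g T).map_rel_iff.2 hadj), hu, hcG, hφ u v hadj, mul_assoc]
  have hLφ (v : V) : L (φ v) = γ v := by
    refine induction_from_root hT r (p := fun v => L (φ v) = γ v) ?_ (fun u v hadj hu => ?_) v
    · rw [hφr, hγr, map_one]
    · rw [hφ u v hadj, map_mul, hu, hLc u v hadj, mul_inv_cancel_left]
  -- Edges inside the tile `S` have trivial label, and `S` is joined to `r` through parents in `S`.
  have hφS (s : V) (hs : s ∈ S) : φ s = 1 := by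
    induction hn : T.dist r s generalizing s with
    | zero => rwa [← hT.connected.dist_eq_zero_iff.1 hn]
    | succ n ih =>
      have hsr : s ≠ r := by rintro rfl; simp at hn
      obtain ⟨u, hu, hadj, hd⟩ := hpar s hs hsr
      have h1 : letter P 1 = 1 := by
        have hP1 : (1 : G) ∉ P := fun h => hP 1 h (by rwa [inv_one])
        simp [letter, hP1]
      have h2 : c u s = 1 := by
        simp only [c]
        rw [show γ u = 1 from hγS 1 u hu, show γ s = 1 from hγS 1 s hs, inv_one, one_mul, h1]
      rw [hφ u s hadj, ih u hu (by omega), h2, one_mul]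
  let F : G →* FreeGroup P :=
    MonoidHom.mk' (fun g => φ ((g : T ≃g T) r)) fun g h => by
      rw [Subgroup.coe_mul, RelIso.mul_apply, hφmul]
  have hLF : L.comp F = MonoidHom.id G := by
    ext1 g
    change L (φ ((g : T ≃g T) r)) = g
    rw [hLφ, hγS g r hr]
  have hFL : F.comp L = MonoidHom.id (FreeGroup P) := by
    refine FreeGroup.ext_hom _ _ fun ⟨x, hx⟩ => ?_
    obtain ⟨-, s, hs, t, ht, hadj⟩ := id hx
    change F (FreeGroup.lift ((↑) : P → G) (FreeGroup.of ⟨x, hx⟩)) = FreeGroup.of ⟨x, hx⟩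
    rw [FreeGroup.lift_apply_of]
    change φ ((x : T ≃g T) r) = _
    -- The edge from `s` to `x t` crosses from the tile `S` to the tile `x S`, so the potential
    -- picks up exactly the letter of `x`.
    have h1 := hφ _ _ hadj
    rw [hφmul, hφS s hs, hφS t ht, mul_one, one_mul] at h1
    rw [h1]
    simp only [c]
    rw [hγS x t ht, show γ s = 1 from hγS 1 s hs, inv_one, one_mul]
    simp [letter, hx]
  exact IsFreeGroup.ofMulEquiv (MonoidHom.toMulEquiv L F hFL hLF)

/-- Purely hyperbolic groups of automorphisms of a tree are free. -/
theorem IsPurelyHyperbolic.isFreeGroup [hT : Fact T.IsTree] {G : Subgroup (T ≃g T)}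
    (hG : IsPurelyHyperbolic G) : IsFreeGroup G := by
  refine isFreeGroup_of_free_action hT.out G (fun g hg v hv => ?_) fun g hg hinv => ?_
  · by_contra hne
    exact (hG g hg hne).apply_ne v hv
  · by_contra hne
    have hgg (v : V) : g (g v) = v := by
      conv_lhs => rw [← RelIso.mul_apply]; arg 1; arg 1; rw [← hinv]
      rw [inv_mul_cancel]
      rfl
    obtain ⟨v, hv | hv⟩ := exists_fixed_or_inverted_of_involutive hT.out g hgg
    · exact (hG g hg hne).apply_ne v hv
    · exact (hG g hg hne).not_inverts hv rfl (hgg v)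

end TreeAut

theorem mainTheorem9 {V : Type*} (T : SimpleGraph V) [Fact T.IsTree] (G : Subgroup (T ≃g T)) :
    ((∀ v, (T.neighborSet v).Finite) → DiscreteTopology G → IsFreeGroup G →
      TreeAut.IsPurelyHyperbolic G) ∧
    (TreeAut.IsPurelyHyperbolic G → DiscreteTopology G ∧ IsFreeGroup G) :=
  ⟨fun hfin _ _ => TreeAut.isPurelyHyperbolic_of_discreteTopology hfin G,
    fun hG => ⟨hG.discreteTopology, hG.isFreeGroup⟩⟩
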